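/- Let $k>0$. A finite-dimensional Frobenius von Neumann $k$-algebra (FN $k$-algebra) $(\mathcal M,\tau,\ast,\rho)$ consists of a nonzero finite-dimensional von Neumann algebra $\mathcal M$ with a faithful positive tracial linear functional $\tau$; a bilinear map $\ast:\mathcal M\times\mathcal M\to\mathcal M$ (a good $k$-convolution) such that $x\ast y\ge 0$ for all $x,y\ge 0$, $\|x\ast y\|_1\le k\|x\|_1\|y\|_1$ and $\tau(x\ast y)=k\,\tau(x)\tau(y)$ for all $x,y\in\mathcal M$; and a linear, trace-preserving anti-$*$-isomorphism $\rho$ of $\mathcal M$ (an antipode) such that $\tau((x\ast y)z)=\tau((\rho(z)\ast x)\rho(y))$ for all $x,y,z\in\mathcal M$. Here $\|x\|_p=\tau(|x|^p)^{1/p}$ for $0<p<\infty$. Theorem 3.15 (reverse Young inequality on finite-dimensional FN $k$-algebras). Let $(\mathcal M,\tau,\ast,\rho)$ be a finite-dimensional FN $k$-algebra, let $\lambda=\min\{\tau(e): e \text{ a nonzero projection in } \mathcal M\}$, and let $0<r,s,t\le 1$ with $1+1/r=1/s+1/t$. Then for all positive $x,y\in\mathcal M$, $$\|x^r\ast y^r\|_r\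 \ge\ \lambda^{1/r-r}\,k\,\|x\|_t^r\,\|y\|_s^r .$$ Moreover, suppose that $e\in\mathcal M$ is a projection with $\tau(e)=1$ and $e\ast x=x\ast e=kx$ for all $x\in\mathcal M$ (as is the Jones projection $e_1$ in the 2-box space of an irreducible subfactor planar algebra of index $\delta^2$ with the unnormalized Markov trace, where $k=\delta^{-1}$). Then for all positive $x,y\in\mathcal M$, $$\|x^r\ast y^r\|_r\ \ge\ k\,\|x\|_t^r\,\|y\|_s^r ,$$ and this bound is sharp: equality holds for $x=y=e$. -/

import Mathlib

section

open scoped ComplexOrder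

/-- A finite-dimensional Frobenius von Neumann `k`-algebra `(M, τ, ∗, ρ)`.

The finite-dimensional von Neumann algebras are exactly the finite-dimensional C⋆-algebras; on them
every linear functional is normal and `L¹(M) = M`, so that the convolution is a bilinear map
`M × M → M`.  Here `CFC.abs x = (x⋆ x)^{1/2}` is the absolute value `|x|`, so that
`τ(|x|) = ‖x‖₁`. -/
structure FNAlgebra (M : Type*) [CStarAlgebra M] [PartialOrder M] [StarOrderedRing M]
    [FiniteDimensional ℂ M] (k : ℝ) where
  k_pos : 0 < k
  /-- the trace `τ`: a faithful positive tracial linear functional -/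
  tau : M →ₗ[ℂ] ℂ
  tau_nonneg : ∀ x : M, 0 ≤ x → 0 ≤ tau x
  tau_faithful : ∀ x : M, 0 ≤ x → tau x = 0 → x = 0
  tau_mul_comm : ∀ x y : M, tau (x * y) = tau (y * x)
  /-- the good `k`-convolution `x ∗ y` -/
  conv : M →ₗ[ℂ] M →ₗ[ℂ] M
  /-- positivity -/
  conv_nonneg : ∀ x y : M, 0 ≤ x → 0 ≤ y → 0 ≤ conv x y
  /-- primary Young inequality `‖x ∗ y‖₁ ≤ k ‖x‖₁ ‖y‖₁` -/
  conv_young : ∀ x y : M,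
    (tau (CFC.abs (conv x y))).re ≤ k * (tau (CFC.abs x)).re * (tau (CFC.abs y)).re
  /-- Haar measure property -/
  conv_haar : ∀ x y : M, tau (conv x y) = k * tau x * tau y
  /-- the antipode `ρ`: a trace-preserving anti-⋆-isomorphism -/
  antipode : M ≃ₗ[ℂ] M
  antipode_mul : ∀ x y : M, antipode (x * y) = antipode y * antipode x
  antipode_star : ∀ x : M, antipode (star x) = star (antipode x)
  tau_antipode : ∀ x : M, tau (antipode x) = tau x
  /-- Frobenius reciprocity -/
  frobenius : ∀ x y z : M,
    tau (conv x y * z) = tau (conv (antipode z) x * antipode y)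

namespace FNAlgebra

variable {M : Type*} [CStarAlgebra M] [PartialOrder M] [StarOrderedRing M]
  [FiniteDimensional ℂ M] {k : ℝ}

/-- `‖x‖_p = τ(|x|^p)^{1/p}` for `0 < p < ∞`, the power `|x|^p` being taken by functional calculus
(the number `τ(|x|^p)` is real and nonnegative). -/
noncomputable def pNorm (F : FNAlgebra M k) (p : ℝ) (x : M) : ℝ :=
  (F.tau (CFC.abs x ^ p)).re ^ (1 / p)

/-- The set of the traces `τ(e)` of the nonzero projections `e` of `M`. -/
def projTraces (F : FNAlgebra M k) : Set ℝ :=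
  {a | ∃ e : M, IsStarProjection e ∧ e ≠ 0 ∧ (F.tau e).re = a}

/-- The minimal trace `λ` of a nonzero projection of `M`. -/
noncomputable def minProjTrace (F : FNAlgebra M k) : ℝ :=
  sInf F.projTraces

/-- The minimum `λ` is attained, and it is positive. -/
theorem minProjTrace_spec [Nontrivial M] (F : FNAlgebra M k) :
    IsLeast F.projTraces F.minProjTrace ∧ 0 < F.minProjTrace := by
  have : ProperSpace M := FiniteDimensional.proper ℂ M
  have hnorm : ∀ e : M, IsStarProjection e → e ≠ 0 → ‖e‖ = 1 := by
    intro e he h0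
    have h1 : ‖star e * e‖ = ‖e‖ * ‖e‖ := CStarRing.norm_star_mul_self
    rw [he.isSelfAdjoint.star_eq, he.isIdempotentElem.eq] at h1
    have h2 : ‖e‖ ≠ 0 := norm_ne_zero_iff.mpr h0
    have h3 : ‖e‖ * (‖e‖ - 1) = 0 := by linarith
    rcases mul_eq_zero.mp h3 with h | h
    · exact absurd h h2
    · linarith
  have hset : F.projTraces =
      (fun e : M => (F.tau e).re) '' ({e : M | e * e = e ∧ star e = e} ∩ Metric.sphere 0 1) := by
    ext a
    constructor
    · rintro ⟨e, he, h0, rfl⟩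
      refine ⟨e, ⟨⟨he.isIdempotentElem.eq, he.isSelfAdjoint.star_eq⟩, ?_⟩, rfl⟩
      simpa using hnorm e he h0
    · rintro ⟨e, ⟨⟨h1, h2⟩, h3⟩, rfl⟩
      refine ⟨e, ⟨h1, h2⟩, ?_, rfl⟩
      rintro rfl
      simp at h3
  have hcont : Continuous fun e : M => (F.tau e).re :=
    Complex.continuous_re.comp F.tau.continuous_of_finiteDimensional
  have hcomp : IsCompact F.projTraces := by
    rw [hset]
    refine IsCompact.image ?_ hcont
    refine IsCompact.inter_left (isCompact_sphere 0 1) ?_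
    exact (isClosed_eq (continuous_id.mul continuous_id) continuous_id).inter
      (isClosed_eq continuous_star continuous_id)
  have hne : F.projTraces.Nonempty :=
    ⟨_, 1, ⟨by simp [IsIdempotentElem], by simp [IsSelfAdjoint]⟩, one_ne_zero, rfl⟩
  have hleast : IsLeast F.projTraces F.minProjTrace := hcomp.isLeast_sInf hne
  refine ⟨hleast, ?_⟩
  obtain ⟨e, he, h0, hea⟩ := hleast.1
  have hpos : 0 ≤ e := by
    have := star_mul_self_nonneg e
    rwa [he.isSelfAdjoint.star_eq, he.isIdempotentElem.eq] at this
  have h1 := F.tau_nonneg e hpos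
  rw [← hea]
  rcases (Complex.le_def.mp h1) with ⟨h2, h3⟩
  refine lt_of_le_of_ne h2 fun h4 => h0 (F.tau_faithful e hpos ?_)
  exact (Complex.ext h4 h3).symm

/-- A projection `e` of trace one which is, up to the factor `k`, a two-sided unit for the
convolution.  In the 2-box space of an irreducible subfactor planar algebra of index `δ²`, with the
unnormalized Markov trace and `k = δ⁻¹`, the Jones projection is such an `e`. -/
structure IsJonesProjection (F : FNAlgebra M k) (e : M) : Prop where
  isStarProjection : IsStarProjection e
  tau_eq_one : F.tau e = 1
  conv_left : ∀ x : M, F.conv e x = (k : ℂ) • x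
  conv_right : ∀ x : M, F.conv x e = (k : ℂ) • x

end FNAlgebra

end

/-!
The convolution enters the reverse Young inequality only through the trace of `c = x ^ r ∗ y ^ r`.
Both `x ^ r` and `y ^ r` are positive, so `c` is positive, and the Haar property gives
`‖c‖₁ = τ(c) = k τ(x ^ r) τ(y ^ r) = k ‖x‖_r ^ r ‖y‖_r ^ r`.  It remains to compare quasinorms with
different exponents: for `0 < p ≤ q` and `a ≥ 0`,
`‖a‖_q ≤ λ ^ (1 / q - 1 / p) ‖a‖_p` (`FNAlgebra.pNorm_le_minProjTrace_rpow_mul_pNorm`).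
Applied to `c` with exponents `r ≤ 1`, to `x` with `r ≤ t` and to `y` with `r ≤ s`, this yields
exactly the power `λ ^ (1 / r - r)`, because `r / s + r / t = r + 1`.

The comparison has two halves, in terms of the largest eigenvalue `‖a‖` of `a`.  On the one hand
`a ^ q ≤ ‖a‖ ^ (q - p) a ^ p`.  On the other hand the eigenprojection `f` for `‖a‖`, which exists
because the spectrum is finite, satisfies `‖a‖ ^ p f ≤ a ^ p`, so `λ ‖a‖ ^ p ≤ τ(a ^ p)`.

When there is a Jones projection `e`, every nonzero projection has trace at least one, so that
`λ ≥ 1` and the constant may be dropped.  Indeed Frobenius reciprocity gives `x ∗ 1 = k τ(x) 1`, and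
positivity of `f ∗ (1 - e)` then says `f ≤ τ(f) 1` for every positive `f`; for a nonzero
projection, compare norms.
-/

section

open scoped ComplexOrder

/-! ### Positive elements of finite-dimensional C⋆-algebras -/

theorem spectrum_finite_of_finiteDimensional {K A : Type*} [Field K] [Ring A] [Algebra K A]
    [FiniteDimensional K A] (a : A) : (spectrum K a).Finite := by
  cases subsingleton_or_nontrivial A
  · simp [spectrum.of_subsingleton]
  have ha : IsIntegral K a := Algebra.IsIntegral.isIntegral a
  refine (Polynomial.finite_setOfPred_isRoot (minpoly.ne_zero ha)).subset fun z hz => ?_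
  have h := spectrum.subset_polynomial_aeval a (minpoly K a) ⟨z, hz, rfl⟩
  rw [minpoly.aeval, spectrum.zero_eq] at h
  exact h

section CStar

variable {M : Type*} [CStarAlgebra M]

theorem IsStarProjection.norm_eq_one {e : M} (he : IsStarProjection e) (h0 : e ≠ 0) :
    ‖e‖ = 1 := by
  have h1 : ‖star e * e‖ = ‖e‖ * ‖e‖ := CStarRing.norm_star_mul_self
  rw [he.isSelfAdjoint.star_eq, he.isIdempotentElem.eq] at h1
  have h2 : ‖e‖ ≠ 0 := norm_ne_zero_iff.mpr h0
  exact mul_left_cancel₀ h2 (by linarith)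

theorem continuousOn_rpow_spectrum (a : M) {p : ℝ} (hp : 0 ≤ p) :
    ContinuousOn (fun x : ℝ => x ^ p) (spectrum ℝ a) :=
  continuousOn_id.rpow_const fun _ _ => Or.inr hp

variable [PartialOrder M] [StarOrderedRing M]

theorem rpow_le_norm_rpow_smul_rpow [Nontrivial M] {a : M} (ha : 0 ≤ a) {p q : ℝ} (hp : 0 < p)
    (hpq : p ≤ q) : a ^ q ≤ (‖a‖ ^ (q - p)) • a ^ p := by
  have hsa : IsSelfAdjoint a := ha.isSelfAdjoint
  rw [CFC.rpow_eq_cfc_real ha, CFC.rpow_eq_cfc_real ha,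
    ← cfc_smul _ _ _ (continuousOn_rpow_spectrum a hp.le)]
  refine cfc_mono (fun x hx => ?_) (continuousOn_rpow_spectrum a (hp.le.trans hpq))
    (continuousOn_const.mul (continuousOn_rpow_spectrum a hp.le))
  have hx0 : 0 ≤ x := spectrum_nonneg_of_nonneg ha hx
  have hxn : x ≤ ‖a‖ := (le_abs_self x).trans (spectrum.norm_le_norm_of_mem hx)
  calc x ^ q = x ^ (q - p) * x ^ p := by
        rw [← Real.rpow_add_of_nonneg hx0 (sub_nonneg.2 hpq) hp.le, sub_add_cancel]
    _ ≤ ‖a‖ ^ (q - p) * x ^ p := by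
        gcongr

/-- The witness is the eigenprojection of `a` for its largest eigenvalue `‖a‖`. -/
theorem exists_isStarProjection_norm_rpow_smul_le [Nontrivial M] [FiniteDimensional ℂ M] {a : M}
    (ha : 0 ≤ a) (p : ℝ) :
    ∃ f : M, IsStarProjection f ∧ f ≠ 0 ∧ (‖a‖ ^ p) • f ≤ a ^ p := by
  classical
  have : FiniteDimensional ℝ M := FiniteDimensional.complexToReal M
  have hsa : IsSelfAdjoint a := ha.isSelfAdjoint
  -- A finite set is discrete, so the functional calculus applies to every function.
  have hcont : ∀ g : ℝ → ℝ, ContinuousOn g (spectrum ℝ a) := fun g =>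
    (spectrum_finite_of_finiteDimensional a).continuousOn g
  let g : ℝ → ℝ := fun x => if x = ‖a‖ then 1 else 0
  refine ⟨cfc g a, ⟨?_, cfc_predicate g a⟩, fun h0 => ?_, ?_⟩
  · rw [IsIdempotentElem, ← cfc_mul g g a (hcont _) (hcont _)]
    congr 1
    ext x
    simp [g]
  · have h1 : g ‖a‖ ∈ spectrum ℝ (cfc g a) := by
      rw [cfc_map_spectrum g a hsa (hcont g)]
      exact ⟨_, CStarAlgebra.norm_mem_spectrum_of_nonneg ha, rfl⟩
    rw [h0, spectrum.zero_eq] at h1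
    simp [g] at h1
  · rw [CFC.rpow_eq_cfc_real ha, ← cfc_smul _ _ _ (hcont g)]
    refine cfc_mono (fun x hx => ?_) (hcont _) (hcont _)
    have hx0 : 0 ≤ x := spectrum_nonneg_of_nonneg ha hx
    by_cases h : x = ‖a‖
    · simp [g, h]
    · simpa [g, h] using Real.rpow_nonneg hx0 p

theorem IsStarProjection.rpow_eq_self {e : M} (he : IsStarProjection e) {p : ℝ} (hp : p ≠ 0) :
    e ^ p = e := by
  have hsa : IsSelfAdjoint e := he.isSelfAdjoint
  rw [CFC.rpow_eq_cfc_real he.nonneg]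
  conv_rhs => rw [← cfc_id ℝ e]
  refine cfc_congr fun x hx => ?_
  rcases he.isIdempotentElem.spectrum_subset ℝ hx with rfl | rfl
  · simp [Real.zero_rpow hp]
  · simp

theorem smul_rpow_eq_rpow_smul_rpow {a : M} (ha : 0 ≤ a) {c : ℝ} (hc : 0 ≤ c) {p : ℝ}
    (hp : 0 ≤ p) : (c • a) ^ p = (c ^ p) • a ^ p := by
  have hsa : IsSelfAdjoint a := ha.isSelfAdjoint
  rw [CFC.rpow_eq_cfc_real (smul_nonneg hc ha), CFC.rpow_eq_cfc_real ha,
    ← cfc_comp_smul c (fun x : ℝ => x ^ p) a (continuousOn_id.rpow_const fun _ _ => Or.inr hp),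
    ← cfc_smul _ _ _ (continuousOn_rpow_spectrum a hp)]
  exact cfc_congr fun x hx => Real.mul_rpow hc (spectrum_nonneg_of_nonneg ha hx)

end CStar

namespace FNAlgebra

variable {M : Type*} [CStarAlgebra M] [PartialOrder M] [StarOrderedRing M]
  [FiniteDimensional ℂ M] {k : ℝ} (F : FNAlgebra M k)

/-! ### Comparison of quasinorms -/

theorem tau_re_nonneg {a : M} (ha : 0 ≤ a) : 0 ≤ (F.tau a).re :=
  (Complex.le_def.mp (F.tau_nonneg a ha)).1

theorem ofReal_tau_re {a : M} (ha : 0 ≤ a) : (((F.tau a).re : ℝ) : ℂ) = F.tau a :=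
  Complex.ext rfl (Complex.le_def.mp (F.tau_nonneg a ha)).2

theorem tau_re_mono {a b : M} (h : a ≤ b) : (F.tau a).re ≤ (F.tau b).re := by
  have := F.tau_re_nonneg (sub_nonneg.2 h)
  rw [map_sub, Complex.sub_re] at this
  linarith

theorem tau_real_smul_re (c : ℝ) (a : M) : (F.tau (c • a)).re = c * (F.tau a).re := by
  rw [← Complex.coe_smul, map_smul]
  simp

theorem pNorm_of_nonneg {a : M} (ha : 0 ≤ a) (p : ℝ) :
    F.pNorm p a = (F.tau (a ^ p)).re ^ (1 / p) := by
  rw [pNorm, CFC.abs_of_nonneg a ha]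

theorem pNorm_nonneg {a : M} (ha : 0 ≤ a) (p : ℝ) : 0 ≤ F.pNorm p a := by
  rw [F.pNorm_of_nonneg ha]
  exact Real.rpow_nonneg (F.tau_re_nonneg CFC.rpow_nonneg) _

theorem pNorm_rpow_self {a : M} (ha : 0 ≤ a) {p : ℝ} (hp : p ≠ 0) :
    F.pNorm p a ^ p = (F.tau (a ^ p)).re := by
  rw [F.pNorm_of_nonneg ha, ← Real.rpow_mul (F.tau_re_nonneg CFC.rpow_nonneg),
    one_div_mul_cancel hp, Real.rpow_one]

theorem pNorm_one {a : M} (ha : 0 ≤ a) : F.pNorm 1 a = (F.tau a).re := by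
  rw [F.pNorm_of_nonneg ha, CFC.rpow_one a ha]
  simp

section Nontrivial

variable [Nontrivial M]

theorem minProjTrace_mul_norm_rpow_le {a : M} (ha : 0 ≤ a) (p : ℝ) :
    F.minProjTrace * ‖a‖ ^ p ≤ (F.tau (a ^ p)).re := by
  obtain ⟨f, hf, hf0, hfa⟩ := exists_isStarProjection_norm_rpow_smul_le ha p
  have h := F.tau_re_mono hfa
  rw [F.tau_real_smul_re] at h
  have hl : F.minProjTrace ≤ (F.tau f).re := F.minProjTrace_spec.1.2 ⟨f, hf, hf0, rfl⟩
  calc F.minProjTrace * ‖a‖ ^ p ≤ (F.tau f).re * ‖a‖ ^ p := by gcongr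
    _ ≤ _ := by rwa [mul_comm]

/-- The analogue of `ℓ^p ⊆ ℓ^q`: the traces of projections are bounded below by `λ`, as the masses
of the points of a discrete measure space would be. -/
theorem pNorm_le_minProjTrace_rpow_mul_pNorm {a : M} (ha : 0 ≤ a) {p q : ℝ} (hp : 0 < p)
    (hpq : p ≤ q) :
    F.pNorm q a ≤ F.minProjTrace ^ (1 / q - 1 / p) * F.pNorm p a := by
  have hq : 0 < q := hp.trans_le hpq
  have hl : 0 < F.minProjTrace := F.minProjTrace_spec.2
  have hN : 0 ≤ F.pNorm p a := F.pNorm_nonneg ha p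
  have hnorm : ‖a‖ ≤ F.minProjTrace ^ (-(1 / p)) * F.pNorm p a := by
    rw [← Real.rpow_le_rpow_iff (norm_nonneg a) (by positivity) hp,
      Real.mul_rpow (by positivity) hN, F.pNorm_rpow_self ha hp.ne', ← Real.rpow_mul hl.le,
      show -(1 / p) * p = -1 by field_simp, Real.rpow_neg_one, inv_mul_eq_div, le_div_iff₀' hl]
    exact F.minProjTrace_mul_norm_rpow_le ha p
  have htau : (F.tau (a ^ q)).re ≤ ‖a‖ ^ (q - p) * (F.tau (a ^ p)).re := by
    rw [← F.tau_real_smul_re]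
    exact F.tau_re_mono (rpow_le_norm_rpow_smul_rpow ha hp hpq)
  rw [← Real.rpow_le_rpow_iff (F.pNorm_nonneg ha q) (by positivity) hq,
    F.pNorm_rpow_self ha hq.ne']
  calc (F.tau (a ^ q)).re ≤ ‖a‖ ^ (q - p) * F.pNorm p a ^ p := by
        rwa [F.pNorm_rpow_self ha hp.ne']
    _ ≤ (F.minProjTrace ^ (-(1 / p)) * F.pNorm p a) ^ (q - p) * F.pNorm p a ^ p := by
        gcongr
    _ = (F.minProjTrace ^ (1 / q - 1 / p) * F.pNorm p a) ^ q := by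
        rw [Real.mul_rpow (by positivity) hN, Real.mul_rpow (by positivity) hN, mul_assoc,
          ← Real.rpow_add_of_nonneg hN (sub_nonneg.2 hpq) hp.le, sub_add_cancel,
          ← Real.rpow_mul hl.le, ← Real.rpow_mul hl.le,
          show -(1 / p) * (q - p) = (1 / q - 1 / p) * q by field_simp; ring]

/-! ### The reverse Young inequality -/

theorem reverse_young {r s t : ℝ} (hr : 0 < r) (hr1 : r ≤ 1) (hs : 0 < s) (hs1 : s ≤ 1)
    (ht : 0 < t) (ht1 : t ≤ 1) (hrst : 1 + 1 / r = 1 / s + 1 / t) {x y : M} (hx : 0 ≤ x)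
    (hy : 0 ≤ y) :
    F.minProjTrace ^ (1 / r - r) * k * F.pNorm t x ^ r * F.pNorm s y ^ r
      ≤ F.pNorm r (F.conv (x ^ r) (y ^ r)) := by
  have hl : 0 < F.minProjTrace := F.minProjTrace_spec.2
  have hk := F.k_pos
  have hrt : r ≤ t := by
    have : 1 ≤ 1 / s := (one_le_div hs).2 hs1
    exact (one_div_le_one_div ht hr).1 (by linarith)
  have hrs : r ≤ s := by
    have : 1 ≤ 1 / t := (one_le_div ht).2 ht1
    exact (one_div_le_one_div hs hr).1 (by linarith)
  have hsum : r / t + r / s = r + 1 := by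
    have h : r * (1 + 1 / r) = r * (1 / s + 1 / t) := by rw [hrst]
    rw [mul_add, mul_one_div_cancel hr.ne'] at h
    rw [div_eq_mul_one_div r t, div_eq_mul_one_div r s]
    linarith
  have hcomp : ∀ {z : M} {q : ℝ}, 0 ≤ z → r ≤ q →
      F.pNorm q z ^ r ≤ F.minProjTrace ^ (r / q - 1) * (F.tau (z ^ r)).re := by
    intro z q hz hrq
    have hq : 0 < q := hr.trans_le hrq
    have h := Real.rpow_le_rpow (F.pNorm_nonneg hz q)
      (F.pNorm_le_minProjTrace_rpow_mul_pNorm hz hr hrq) hr.le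
    rwa [Real.mul_rpow (by positivity) (F.pNorm_nonneg hz r), F.pNorm_rpow_self hz hr.ne',
      ← Real.rpow_mul hl.le, show (1 / q - 1 / r) * r = r / q - 1 by field_simp] at h
  have hxr : (0 : M) ≤ x ^ r := CFC.rpow_nonneg
  have hyr : (0 : M) ≤ y ^ r := CFC.rpow_nonneg
  have hA := F.tau_re_nonneg hxr
  have hB := F.tau_re_nonneg hyr
  have hc : 0 ≤ F.conv (x ^ r) (y ^ r) := F.conv_nonneg _ _ hxr hyr
  have hhaar : (F.tau (F.conv (x ^ r) (y ^ r))).re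
      = k * (F.tau (x ^ r)).re * (F.tau (y ^ r)).re := by
    rw [F.conv_haar, ← F.ofReal_tau_re hxr, ← F.ofReal_tau_re hyr]
    norm_cast
  have hone : (F.tau (F.conv (x ^ r) (y ^ r))).re
      ≤ F.minProjTrace ^ (1 - 1 / r) * F.pNorm r (F.conv (x ^ r) (y ^ r)) := by
    have h := F.pNorm_le_minProjTrace_rpow_mul_pNorm hc hr hr1
    rwa [F.pNorm_one hc, one_div_one] at h
  have hyn := Real.rpow_nonneg (F.pNorm_nonneg hy s) r
  calc F.minProjTrace ^ (1 / r - r) * k * F.pNorm t x ^ r * F.pNorm s y ^ r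
      ≤ F.minProjTrace ^ (1 / r - r) * k * (F.minProjTrace ^ (r / t - 1) * (F.tau (x ^ r)).re)
          * (F.minProjTrace ^ (r / s - 1) * (F.tau (y ^ r)).re) := by
        gcongr
        · exact hcomp hx hrt
        · exact hcomp hy hrs
    _ = F.minProjTrace ^ (1 / r - r) * F.minProjTrace ^ (r / t - 1)
          * F.minProjTrace ^ (r / s - 1) * (F.tau (F.conv (x ^ r) (y ^ r))).re := by
        rw [hhaar]
        ring
    _ = F.minProjTrace ^ (1 / r - 1) * (F.tau (F.conv (x ^ r) (y ^ r))).re := by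
        rw [← Real.rpow_add hl, ← Real.rpow_add hl]
        congr 2
        linarith
    _ ≤ F.minProjTrace ^ (1 / r - 1)
          * (F.minProjTrace ^ (1 - 1 / r) * F.pNorm r (F.conv (x ^ r) (y ^ r))) := by
        gcongr
    _ = F.pNorm r (F.conv (x ^ r) (y ^ r)) := by
        rw [← mul_assoc, ← Real.rpow_add hl]
        simp

end Nontrivial

/-! ### Algebras with a Jones projection -/

theorem antipode_one : F.antipode 1 = 1 := by
  obtain ⟨u, hu⟩ := F.antipode.surjective 1
  have h := F.antipode_mul u 1
  rwa [mul_one, hu, mul_one, eq_comm] at h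

theorem conv_one (x : M) : F.conv x 1 = ((k : ℂ) * F.tau x) • (1 : M) := by
  rw [← sub_eq_zero]
  set d := F.conv x 1 - ((k : ℂ) * F.tau x) • (1 : M) with hd
  have h : ∀ z, F.tau (d * z) = 0 := by
    intro z
    rw [hd, sub_mul, map_sub, F.frobenius, F.antipode_one, mul_one, F.conv_haar, F.tau_antipode,
      smul_one_mul, map_smul, smul_eq_mul]
    ring
  exact CStarRing.mul_star_self_eq_zero_iff d |>.1
    (F.tau_faithful _ (mul_star_self_nonneg d) (h _))

theorem IsJonesProjection.le_algebraMap_tau {F : FNAlgebra M k} {e : M}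
    (he : F.IsJonesProjection e) {f : M} (hf : 0 ≤ f) : f ≤ algebraMap ℝ M (F.tau f).re := by
  have h := F.conv_nonneg f (1 - e) hf (sub_nonneg.2 he.isStarProjection.le_one)
  rw [map_sub, F.conv_one, he.conv_right, mul_smul, ← smul_sub, ← F.ofReal_tau_re hf,
    Complex.coe_smul, Complex.coe_smul, ← Algebra.algebraMap_eq_smul_one] at h
  exact sub_nonneg.1 ((smul_nonneg_iff_nonneg_of_pos_left F.k_pos).1 h)

theorem IsJonesProjection.one_le_minProjTrace [Nontrivial M] {F : FNAlgebra M k} {e : M}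
    (he : F.IsJonesProjection e) : 1 ≤ F.minProjTrace := by
  obtain ⟨f, hf, hf0, hfa⟩ := F.minProjTrace_spec.1.1
  rw [← hfa, ← hf.norm_eq_one hf0]
  exact (CStarAlgebra.norm_le_iff_le_algebraMap f (F.tau_re_nonneg hf.nonneg) hf.nonneg).2
    (he.le_algebraMap_tau hf.nonneg)

theorem IsJonesProjection.pNorm_eq_one {F : FNAlgebra M k} {e : M}
    (he : F.IsJonesProjection e) {p : ℝ} (hp : p ≠ 0) : F.pNorm p e = 1 := by
  rw [F.pNorm_of_nonneg he.isStarProjection.nonneg, he.isStarProjection.rpow_eq_self hp,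
    he.tau_eq_one]
  simp

theorem IsJonesProjection.pNorm_conv_self {F : FNAlgebra M k} {e : M}
    (he : F.IsJonesProjection e) {p : ℝ} (hp : 0 < p) : F.pNorm p (F.conv e e) = k := by
  have hk := F.k_pos
  have he0 := he.isStarProjection.nonneg
  have hc := F.conv_nonneg e e he0 he0
  rw [F.pNorm_of_nonneg hc, he.conv_left, Complex.coe_smul,
    smul_rpow_eq_rpow_smul_rpow he0 hk.le hp.le, F.tau_real_smul_re,
    he.isStarProjection.rpow_eq_self hp.ne', he.tau_eq_one, Complex.one_re, mul_one,
    ← Real.rpow_mul hk.le, mul_one_div_cancel hp.ne', Real.rpow_one]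

end FNAlgebra

end

/-- Quantum reverse Young inequality on finite-dimensional FN `k`-algebras; with its form for
algebras with a Jones projection, where the minimal projection trace disappears from the constant
and the resulting bound is attained. -/
theorem theorem3p15 {M : Type*} [CStarAlgebra M] [PartialOrder M] [StarOrderedRing M]
    [FiniteDimensional ℂ M] [Nontrivial M] {k : ℝ} (F : FNAlgebra M k)
    (r s t : ℝ) (hr : 0 < r) (hr1 : r ≤ 1) (hs : 0 < s) (hs1 : s ≤ 1) (ht : 0 < t) (ht1 : t ≤ 1)
    (hrst : 1 + 1 / r = 1 / s + 1 / t) :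
    (∀ x y : M, 0 ≤ x → 0 ≤ y →
      F.minProjTrace ^ (1 / r - r) * k * F.pNorm t x ^ r * F.pNorm s y ^ r
        ≤ F.pNorm r (F.conv (x ^ r) (y ^ r))) ∧
    (∀ e : M, F.IsJonesProjection e →
      (∀ x y : M, 0 ≤ x → 0 ≤ y →
        k * F.pNorm t x ^ r * F.pNorm s y ^ r ≤ F.pNorm r (F.conv (x ^ r) (y ^ r))) ∧
      F.pNorm r (F.conv (e ^ r) (e ^ r)) = k * F.pNorm t e ^ r * F.pNorm s e ^ r) := by
  refine ⟨fun x y hx hy => F.reverse_young hr hr1 hs hs1 ht ht1 hrst hx hy, fun e he => ⟨?_, ?_⟩⟩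
  · intro x y hx hy
    refine le_trans ?_ (F.reverse_young hr hr1 hs hs1 ht ht1 hrst hx hy)
    have hk := F.k_pos
    have hxn := Real.rpow_nonneg (F.pNorm_nonneg hx t) r
    have hyn := Real.rpow_nonneg (F.pNorm_nonneg hy s) r
    have hexp : 0 ≤ 1 / r - r := sub_nonneg.2 (hr1.trans ((one_le_div hr).2 hr1))
    have hone := Real.one_le_rpow he.one_le_minProjTrace hexp
    gcongr
    exact le_mul_of_one_le_left hk.le hone
  · rw [he.isStarProjection.rpow_eq_self hr.ne', he.pNorm_conv_self hr, he.pNorm_eq_one ht.ne',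
      he.pNorm_eq_one hs.ne']
    simp
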